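/- Let $\mathbf A$ be a real $n\times n$ matrix, $n\ge 1$. A real square matrix $(b_{st})$ with index set $I$ is strictly J-sign-symmetric (SJS) if it has no zero entries and for some subset $J\subseteq I$ (with $J^c=I\setminus J$) one has $b_{st}\ge 0$ on $(J\times J)\cup(J^c\times J^c)$ and $b_{st}\le 0$ on $(J\times J^c)\cup(J^c\times J)$. The $j$-th compound matrix $\mathbf A^{(j)}$ is the matrix of all minors of order $j$ of $\mathbf A$, its rows and columns being indexed by the sequences $1\le i_1<\dots<i_j\le n$. The matrix $\mathbf A$ is strictly totally J-sign-symmetric (STJS) if $\mathbf A^{(j)}$ is SJS for every $j=1,\dots,n$ (with a set $J$ that may depend on $j$). Let $\mathbf A$ be an STJS matrix. (a) Suppose $n\ge 2$. Let $\lambda_1,\dots,\lambda_n$ be the eigenvalues of $\mathbf A$ and, for $k=1,\dots,n$, let $\mu_1^{(k)},\dots,\mu_{n-1}^{(k)}$ be the eigenvalues of the principal submatrix of $\mathbf A$ obtained by deleting the $k$-th row and the $k$-th column, in both cases listed with multiplicities in decreasing order of absolute values. Then for every $k=1,\dots,n$ the numbers $\lambda_1,\mu_1^{(k)},\mu_{n-1}^{(k)},\lambda_n$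 are real and $$\lambda_1>\mu_1^{(k)},\qquad \mu_{n-1}^{(k)}>\lambda_n .$$ (b) (Corollary 1) $\mathbf A$ is a $\tau^<$-matrix. That is, if $l(\mathbf M)$ denotes the smallest real eigenvalue of a real square matrix $\mathbf M$ (with $l(\mathbf M)=\infty$ if $\mathbf M$ has no real eigenvalue) and $\mathbf A(\alpha)$ the principal submatrix of $\mathbf A$ with rows and columns from $\alpha\subseteq\{1,\dots,n\}$, then $l(\mathbf A)>0$, $l(\mathbf A(\alpha))\le l(\mathbf A(\beta))<\infty$ whenever $\emptyset\ne\beta\subseteq\alpha\subseteq\{1,\dots,n\}$, and $l(\mathbf A(\alpha))<l(\mathbf A(\beta))$ whenever, moreover, $\beta\ne\alpha$. -/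

import Mathlib

/-- The `j`-th compound matrix: its entries are the minors of order `j`, the rows and columns being
labelled by the strictly increasing sequences `i₁ < ⋯ < iⱼ` of indices. -/
def compoundMatrix {n : ℕ} (A : Matrix (Fin n) (Fin n) ℝ) (j : ℕ) :
    Matrix (Fin j ↪o Fin n) (Fin j ↪o Fin n) ℝ :=
  fun α β => (A.submatrix α β).det

/-- `A` is nonnegative on `(J × J) ∪ (Jᶜ × Jᶜ)` and nonpositive on `(J × Jᶜ) ∪ (Jᶜ × J)`. -/
def IsSignSymmetricWith {ι : Type*} (A : Matrix ι ι ℝ) (J : Set ι) : Prop :=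
  (∀ i j, (i ∈ J ∧ j ∈ J) ∨ (i ∉ J ∧ j ∉ J) → 0 ≤ A i j) ∧
  (∀ i j, (i ∈ J ∧ j ∉ J) ∨ (i ∉ J ∧ j ∈ J) → A i j ≤ 0)

/-- J-sign-symmetric (JS) matrices. -/
def IsJS {ι : Type*} (A : Matrix ι ι ℝ) : Prop :=
  ∃ J : Set ι, IsSignSymmetricWith A J

/-- Strictly J-sign-symmetric (SJS) matrices. -/
def IsSJS {ι : Type*} (A : Matrix ι ι ℝ) : Prop :=
  IsJS A ∧ ∀ i j, A i j ≠ 0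

/-- Strictly totally J-sign-symmetric (STJS) matrices. -/
def IsSTJS {n : ℕ} (A : Matrix (Fin n) (Fin n) ℝ) : Prop :=
  ∀ j : ℕ, 1 ≤ j → j ≤ n → IsSJS (compoundMatrix A j)

/-- `ev` lists all the (complex) eigenvalues of the real matrix `A`, with their algebraic
multiplicities, in decreasing order of their absolute values. -/
def IsEigenvalueList {n : ℕ} (A : Matrix (Fin n) (Fin n) ℝ) (ev : Fin n → ℂ) : Prop :=
  Multiset.map ev Finset.univ.val = (A.map Complex.ofReal).charpoly.roots ∧
  Antitone (fun i => ‖ev i‖)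

/-- The `n × n` principal submatrix obtained by deleting the `k`-th row and column. -/
def deleteRowCol {n : ℕ} (A : Matrix (Fin (n + 1)) (Fin (n + 1)) ℝ) (k : Fin (n + 1)) :
    Matrix (Fin n) (Fin n) ℝ :=
  A.submatrix k.succAbove k.succAbove

/-- `l(A)`, the smallest real eigenvalue of `A`, and `⊤` if `A` has no real eigenvalue. (The set
of real eigenvalues is finite, so the infimum is a minimum when the set is not empty.) -/
noncomputable def minRealEigenvalue {ι : Type*} [Fintype ι] [DecidableEq ι]
    (A : Matrix ι ι ℝ) : EReal :=
  sInf ((fun x : ℝ => (x : EReal)) '' spectrum ℝ A)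

/-- The principal submatrix `A(α)`, formed by the rows and columns with indices from `α`. -/
def principalSubmatrix {n : ℕ} (A : Matrix (Fin n) (Fin n) ℝ) (α : Finset (Fin n)) :
    Matrix α α ℝ :=
  A.submatrix Subtype.val Subtype.val

/-- `τ`-matrices. -/
def IsTauMatrix {n : ℕ} (A : Matrix (Fin n) (Fin n) ℝ) : Prop :=
  0 ≤ minRealEigenvalue A ∧
  ∀ α β : Finset (Fin n), β.Nonempty → β ⊆ α →
    minRealEigenvalue (principalSubmatrix A α) ≤ minRealEigenvalue (principalSubmatrix A β) ∧
    minRealEigenvalue (principalSubmatrix A β) < ⊤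

/-- Strict `τ`-matrices (`τ^<`-matrices): the monotonicity is strict for proper subsets. -/
def IsStrictTauMatrix {n : ℕ} (A : Matrix (Fin n) (Fin n) ℝ) : Prop :=
  IsTauMatrix A ∧ 0 < minRealEigenvalue A ∧
  ∀ α β : Finset (Fin n), β.Nonempty → β ⊂ α →
    minRealEigenvalue (principalSubmatrix A α) < minRealEigenvalue (principalSubmatrix A β)

/-!
An STJS matrix `A` is signature similar to a positive matrix (its minors of order one), and so is
`A⁻¹` (up to the factor `1 / det A > 0` and the signature `(-1)ⁱ`, it is the transpose of the
compound matrix of order `n - 1`). These two facts, applied to `A` and to its principal submatrices,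
which are STJS again, carry everything; the compound matrices of the other orders enter only through
their diagonals, the principal minors, which are positive.

* By Perron's theorem (`exists_perron_eigenvector`, `eigenvalue_eq_perron`), the eigenvalue of
  largest modulus of `A` is the Perron root `ρ`, and that of smallest modulus is the inverse of the
  Perron root of `A⁻¹`. As the principal minors are positive, `det (A + t) > 0` for `t ≥ 0`
  (`det_add_smul_one_pos`), so all real eigenvalues are positive and the eigenvalue of smallest
  modulus is also the smallest real one.
* An eigenvector `z` of a principal submatrix to the eigenvalue `μ`, extended by zero, satisfies
  `|μ| |z| ≤ P |z|`, where `P` is the positive matrix similar to `A`. Comparison with the Perron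
  eigenvector gives `|μ| < ρ` (`norm_eigenvalue_submatrix_lt_perron`).
* Let `l` be the smallest eigenvalue of `A`, and let `y` be a real eigenvector, to the eigenvalue
  `μ > 0`, of the submatrix obtained by deleting the index `k`. Extended by zero it satisfies
  `A y = μ y + c eₖ`, that is `y - μ A⁻¹ y = c A⁻¹ eₖ`, whose right-hand side has, after the
  signature similarity, a constant sign. If `μ ≤ l`, a minimum principle (`eq_zero_of_mulVec_le`)
  makes `±y` positive or zero, contradicting `y k = 0`. Hence `l < μ`
  (`HasPerronInverse.exists_smallest`), and the strict monotonicity of the smallest real eigenvalue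
  follows by deleting one index at a time.
-/

/-! ### Perron's theorem for positive matrices -/

section Perron

variable {ι κ : Type} [Fintype ι] [Fintype κ]

lemma mulVec_pos_of_pos {P : Matrix ι ι ℝ} (hP : ∀ i j, 0 < P i j) {q : ι → ℝ}
    (hq : ∀ i, 0 ≤ q i) (hq0 : q ≠ 0) (i : ι) : 0 < (P.mulVec q) i := by
  obtain ⟨j, hj⟩ := Function.ne_iff.1 hq0
  exact Finset.sum_pos' (fun j _ => mul_nonneg (hP i j).le (hq j))
    ⟨j, Finset.mem_univ _, mul_pos (hP i j) (lt_of_le_of_ne (hq j) (Ne.symm hj))⟩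

/-- Existence of the Perron eigenvector: among all `(x, t)` with `x` in the standard simplex and
`t x ≤ P x`, take one with `t` maximal; were `P x ≠ t x`, the vector `P x` would satisfy
`t (P x) < P (P x)` in every coordinate, and `t` could be increased. -/
theorem exists_perron_eigenvector [Nonempty ι] {P : Matrix ι ι ℝ} (hP : ∀ i j, 0 < P i j) :
    ∃ ρ : ℝ, 0 < ρ ∧ ∃ v : ι → ℝ, (∀ i, 0 < v i) ∧ P.mulVec v = ρ • v := by
  classical
  set M : ℝ := ∑ i, ∑ j, P i j with hM
  set K : Set ((ι → ℝ) × ℝ) :=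
    (stdSimplex ℝ ι ×ˢ Set.Icc 0 M) ∩ {p | ∀ i, p.2 * p.1 i ≤ (P.mulVec p.1) i} with hK
  have hKc : IsCompact K := by
    refine ((isCompact_stdSimplex ℝ ι).prod isCompact_Icc).inter_right ?_
    simp only [Set.ofPred_forall]
    refine isClosed_iInter fun i => isClosed_le (by fun_prop) ?_
    simp only [Matrix.mulVec, dotProduct]
    fun_prop
  have hMpos : 0 ≤ M := Finset.sum_nonneg fun i _ => Finset.sum_nonneg fun j _ => (hP i j).le
  have hKn : K.Nonempty := by
    obtain ⟨k⟩ := ‹Nonempty ι›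
    have h1 : (Pi.single k 1 : ι → ℝ) ∈ stdSimplex ℝ ι := single_mem_stdSimplex ℝ k
    refine ⟨(Pi.single k 1, 0), ⟨h1, by simp [hMpos]⟩, fun i => ?_⟩
    simpa using (hP i k).le
  obtain ⟨⟨x, t⟩, hxt, hmax⟩ := hKc.exists_isMaxOn hKn continuous_snd.continuousOn
  obtain ⟨⟨hx, ht0, htM⟩, hle⟩ := hxt
  simp only [Set.mem_ofPred_eq] at hx ht0 htM hle
  have hx0 : x ≠ 0 := by
    rintro rfl
    simpa using hx.2
  have hy : ∀ i, 0 < (P.mulVec x) i := mulVec_pos_of_pos hP hx.1 hx0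
  have heq : P.mulVec x = t • x := by
    by_contra hne
    set y := P.mulVec x with hydef
    have hq : ∀ i, 0 < (P.mulVec (y - t • x)) i :=
      mulVec_pos_of_pos hP (fun i => by simpa using hle i) (sub_ne_zero.2 hne)
    have hq' : ∀ i, t * y i < (P.mulVec y) i := by
      intro i
      have := hq i
      rw [Matrix.mulVec_sub, Matrix.mulVec_smul, ← hydef] at this
      simpa using this
    obtain ⟨i₀, hi₀⟩ := Finite.exists_min fun i => (P.mulVec y) i / y i
    set t' := (P.mulVec y) i₀ / y i₀
    have htt' : t < t' := (lt_div_iff₀ (hy i₀)).2 (hq' i₀)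
    set s := ∑ i, y i
    have hs : 0 < s := Finset.sum_pos (fun i _ => hy i) Finset.univ_nonempty
    have hw : s⁻¹ • y ∈ stdSimplex ℝ ι :=
      ⟨fun i => mul_nonneg (inv_nonneg.2 hs.le) (hy i).le, by
        simp only [Pi.smul_apply, smul_eq_mul, ← Finset.mul_sum]
        exact inv_mul_cancel₀ hs.ne'⟩
    have hle' : ∀ i, t' * (s⁻¹ • y) i ≤ (P.mulVec (s⁻¹ • y)) i := by
      intro i
      have := (le_div_iff₀ (hy i)).1 (hi₀ i)
      rw [Matrix.mulVec_smul]
      simp only [Pi.smul_apply, smul_eq_mul]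
      rw [mul_left_comm]
      exact mul_le_mul_of_nonneg_left this (inv_nonneg.2 hs.le)
    have ht'M : t' ≤ M := by
      calc t' = ∑ i, t' * (s⁻¹ • y) i := by rw [← Finset.mul_sum, hw.2, mul_one]
        _ ≤ ∑ i, (P.mulVec (s⁻¹ • y)) i := Finset.sum_le_sum fun i _ => hle' i
        _ ≤ M := Finset.sum_le_sum fun i _ => Finset.sum_le_sum fun j _ =>
            mul_le_of_le_one_right (hP i j).le (by
              rw [← hw.2]
              exact Finset.single_le_sum (fun i _ => hw.1 i) (Finset.mem_univ j))
    have := hmax (show (s⁻¹ • y, t') ∈ K from ⟨⟨hw, ht0.trans htt'.le, ht'M⟩, hle'⟩)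
    simp only [Set.mem_ofPred_eq] at this
    exact absurd htt' (not_lt.2 this)
  have htx : ∀ i, 0 < t * x i := fun i => by
    have := hy i
    rw [heq] at this
    simpa using this
  obtain ⟨k⟩ := ‹Nonempty ι›
  have ht : 0 < t := pos_of_mul_pos_left (htx k) (hx.1 k)
  exact ⟨t, ht, x, fun i => pos_of_mul_pos_right (htx i) ht.le, heq⟩

/-- A nonnegative vector `x ≠ 0` with `r x ≤ P x` forces `r ≤ ρ`, strictly if `x` has a zero
entry: look at a coordinate where `x i / v i` is largest. -/
lemma le_perron_of_le_mulVec {P : Matrix ι ι ℝ} (hP : ∀ i j, 0 < P i j) {ρ : ℝ} {v : ι → ℝ}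
    (hv : ∀ i, 0 < v i) (hPv : P.mulVec v = ρ • v) {r : ℝ} {x : ι → ℝ} (hx : ∀ i, 0 ≤ x i)
    (hx0 : x ≠ 0) (hr : ∀ i, r * x i ≤ (P.mulVec x) i) :
    r ≤ ρ ∧ ((∃ k, x k = 0) → r < ρ) := by
  obtain ⟨j, hj⟩ := Function.ne_iff.1 hx0
  have : Nonempty ι := ⟨j⟩
  obtain ⟨i, hi⟩ := Finite.exists_max fun i => x i / v i
  set s := x i / v i with hs
  have hs0 : 0 < s :=
    (div_pos (lt_of_le_of_ne (hx j) (Ne.symm hj)) (hv j)).trans_le (hi j)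
  have hxi : x i = s * v i := (div_mul_cancel₀ _ (hv i).ne').symm
  set q := s • v - x with hq
  have hq0 : ∀ l, 0 ≤ q l := fun l => by
    simpa [hq] using (div_le_iff₀ (hv l)).1 (hi l)
  have hPq : (P.mulVec q) i ≤ s * v i * (ρ - r) := by
    have := hr i
    rw [hq, Matrix.mulVec_sub, Matrix.mulVec_smul, hPv]
    simp only [Pi.sub_apply, Pi.smul_apply, smul_eq_mul]
    rw [hxi] at this
    linarith
  have hsv := mul_pos hs0 (hv i)
  constructor
  · have h0 : 0 ≤ (P.mulVec q) i := Finset.sum_nonneg fun l _ => mul_nonneg (hP i l).le (hq0 l)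
    exact sub_nonneg.1 (nonneg_of_mul_nonneg_right (h0.trans hPq) hsv)
  · rintro ⟨k, hk⟩
    have hqk : q ≠ 0 := fun h => by
      have := congrFun h k
      simp only [hq, Pi.sub_apply, Pi.smul_apply, smul_eq_mul, hk, sub_zero, Pi.zero_apply] at this
      exact (mul_pos hs0 (hv k)).ne' this
    exact sub_pos.1 (pos_of_mul_pos_right
      ((mulVec_pos_of_pos hP hq0 hqk i).trans_le hPq) hsv.le)

/-- A minimum principle: if `μ ρ ≤ 1`, a vector `y` with `y ≥ μ P y` is nonnegative, and
positive unless it vanishes; so it cannot have a zero entry. -/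
lemma eq_zero_of_mulVec_le {P : Matrix ι ι ℝ} (hP : ∀ i j, 0 < P i j) {ρ : ℝ} {v : ι → ℝ}
    (hv : ∀ i, 0 < v i) (hPv : P.mulVec v = ρ • v) {μ : ℝ} (hμ : 0 < μ) (hμρ : μ * ρ ≤ 1)
    {y : ι → ℝ} {k : ι} (hk : y k = 0) (hy : ∀ i, μ * (P.mulVec y) i ≤ y i) : y = 0 := by
  have : Nonempty ι := ⟨k⟩
  obtain ⟨i, hi⟩ := Finite.exists_min fun i => y i / v i
  set s := y i / v i with hs
  have hs0 : s ≤ 0 := by simpa [hk] using hi k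
  have hyi : y i = s * v i := (div_mul_cancel₀ _ (hv i).ne').symm
  set q := y - s • v with hq
  have hq0 : ∀ l, 0 ≤ q l := fun l => by
    simpa [hq] using (le_div_iff₀ (hv l)).1 (hi l)
  have hqz : q = 0 := by
    by_contra hne
    have h1 := mulVec_pos_of_pos hP hq0 hne i
    have h2 := hy i
    rw [hq, Matrix.mulVec_sub, Matrix.mulVec_smul, hPv] at h1
    simp only [Pi.sub_apply, Pi.smul_apply, smul_eq_mul] at h1
    have h3 : 0 ≤ s * v i * (μ * ρ - 1) :=
      mul_nonneg_of_nonpos_of_nonpos (mul_nonpos_of_nonpos_of_nonneg hs0 (hv i).le)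
        (by linarith)
    have h4 := mul_pos hμ h1
    rw [hyi] at h2
    nlinarith
  have hysv : y = s • v := sub_eq_zero.1 hqz
  have hs00 : s = 0 := by
    have := congrFun hysv k
    rw [hk, Pi.smul_apply, smul_eq_mul] at this
    exact (mul_eq_zero.1 this.symm).resolve_right (hv k).ne'
  rw [hysv, hs00, zero_smul]

lemma norm_mul_le_mulVec_norm {P : Matrix ι ι ℝ} (hP : ∀ i j, 0 < P i j) {z : ι → ℂ} {lam : ℂ}
    {i : ι} (h : ((P.map Complex.ofReal).mulVec z) i = lam * z i) :
    ‖lam‖ * ‖z i‖ ≤ (P.mulVec fun j => ‖z j‖) i := by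
  rw [← norm_mul, ← h]
  refine (norm_sum_le _ _).trans (Finset.sum_le_sum fun j _ => ?_)
  simp [abs_of_pos (hP i j)]

lemma norm_eigenvalue_le_perron {P : Matrix ι ι ℝ} (hP : ∀ i j, 0 < P i j) {ρ : ℝ} {v : ι → ℝ}
    (hv : ∀ i, 0 < v i) (hPv : P.mulVec v = ρ • v) {z : ι → ℂ} (hz : z ≠ 0) {lam : ℂ}
    (h : (P.map Complex.ofReal).mulVec z = lam • z) : ‖lam‖ ≤ ρ :=
  (le_perron_of_le_mulVec hP hv hPv (x := fun j => ‖z j‖) (fun _ => norm_nonneg _)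
    (fun h0 => hz (funext fun i => norm_eq_zero.1 (congrFun h0 i)))
    fun _ => norm_mul_le_mulVec_norm hP (by rw [h]; rfl)).1

/-- The Perron root is the only eigenvalue on its circle: for small `ε > 0` the matrix `P - ε`
is still positive and has Perron root `ρ - ε`, and the disc of centre `ε` and radius `ρ - ε` meets
the circle of radius `ρ` only in `ρ`. -/
lemma eigenvalue_eq_perron [DecidableEq ι] {P : Matrix ι ι ℝ} (hP : ∀ i j, 0 < P i j)
    {ρ : ℝ} {v : ι → ℝ} (hv : ∀ i, 0 < v i) (hPv : P.mulVec v = ρ • v) {z : ι → ℂ} (hz : z ≠ 0)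
    {lam : ℂ} (h : (P.map Complex.ofReal).mulVec z = lam • z) (hlam : ‖lam‖ = ρ) :
    lam = ρ := by
  obtain ⟨j, -⟩ := Function.ne_iff.1 hz
  have : Nonempty ι := ⟨j⟩
  obtain ⟨i₀, hi₀⟩ := Finite.exists_min fun i => P i i
  set ε := P i₀ i₀ / 2 with hε
  have hε0 : 0 < ε := half_pos (hP i₀ i₀)
  have hP' : ∀ i j, 0 < (P - ε • (1 : Matrix ι ι ℝ)) i j := by
    intro i j
    rcases eq_or_ne i j with rfl | hij
    · have := hi₀ i
      have := hP i₀ i₀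
      simp only [Matrix.sub_apply, Matrix.smul_apply, Matrix.one_apply_eq, smul_eq_mul, mul_one]
      linarith
    · simpa [Matrix.one_apply_ne hij] using hP i j
  have hmap : (P - ε • (1 : Matrix ι ι ℝ)).map Complex.ofReal
      = P.map Complex.ofReal - (ε : ℂ) • (1 : Matrix ι ι ℂ) := by
    ext i j
    rcases eq_or_ne i j with rfl | hij
    · simp
    · simp [Matrix.one_apply_ne hij]
  have key : ‖lam - ε‖ ≤ ρ - ε := by
    refine norm_eigenvalue_le_perron hP' hv ?_ hz ?_
    · rw [Matrix.sub_mulVec, hPv, Matrix.smul_mulVec, Matrix.one_mulVec, sub_smul]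
    · rw [hmap, Matrix.sub_mulVec, h, Matrix.smul_mulVec, Matrix.one_mulVec, sub_smul]
  have h1 : ‖lam - ε‖ ^ 2 ≤ (ρ - ε) ^ 2 := pow_le_pow_left₀ (norm_nonneg _) key 2
  have h2 : ‖lam‖ ^ 2 = ρ ^ 2 := by rw [hlam]
  rw [Complex.sq_norm, Complex.normSq_apply] at h1 h2
  simp only [Complex.sub_re, Complex.sub_im, Complex.ofReal_re, Complex.ofReal_im, sub_zero] at h1
  have h3 : ρ ≤ lam.re := by
    have : ε * ρ ≤ ε * lam.re := by nlinarith
    exact le_of_mul_le_mul_left this hε0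
  have h4 : lam.re = ρ := le_antisymm (hlam ▸ Complex.re_le_norm lam) h3
  have h5 : lam.im = 0 := by
    rw [h4] at h2
    exact mul_self_eq_zero.1 (by nlinarith)
  exact Complex.ext (by simpa using h4) (by simpa using h5)

/-- A row of a matrix against a vector extended by zero along an injective map. -/
lemma sum_mul_extend_zero {R : Type*} [NonUnitalNonAssocSemiring R] {f : κ → ι}
    (hf : Function.Injective f) (g : ι → R) (y : κ → R) :
    ∑ i, g i * Function.extend f y 0 i = ∑ j, g (f j) * y j := by
  classical
  rw [← Finset.sum_subset (Finset.subset_univ (Finset.univ.image f)), Finset.sum_image hf.injOn]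
  · simp [hf.extend_apply]
  · intro i _ hi
    rw [Function.extend_apply' _ _ _ (by simpa using hi)]
    simp

lemma norm_eigenvalue_submatrix_lt_perron {P : Matrix ι ι ℝ} (hP : ∀ i j, 0 < P i j) {ρ : ℝ}
    {v : ι → ℝ} (hv : ∀ i, 0 < v i) (hPv : P.mulVec v = ρ • v) {f : κ → ι}
    (hf : Function.Injective f) {k : ι} (hk : k ∉ Set.range f) {z : κ → ℂ} (hz : z ≠ 0) {mu : ℂ}
    (h : ((P.submatrix f f).map Complex.ofReal).mulVec z = mu • z) : ‖mu‖ < ρ := by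
  set x : ι → ℝ := Function.extend f (fun j => ‖z j‖) 0 with hx
  have hxf : ∀ j, x (f j) = ‖z j‖ := fun j => hf.extend_apply _ _ j
  have hxn : ∀ i, i ∉ Set.range f → x i = 0 := fun i hi =>
    Function.extend_apply' _ _ _ hi
  have hx0 : ∀ i, 0 ≤ x i := fun i => by
    by_cases hi : i ∈ Set.range f
    · obtain ⟨j, rfl⟩ := hi
      rw [hxf]
      exact norm_nonneg _
    · rw [hxn i hi]
  refine (le_perron_of_le_mulVec hP hv hPv hx0 (fun h0 => hz (funext fun j => ?_))
    fun i => ?_).2 ⟨k, hxn k hk⟩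
  · exact norm_eq_zero.1 ((hxf j).symm.trans (congrFun h0 (f j)))
  · by_cases hi : i ∈ Set.range f
    · obtain ⟨j, rfl⟩ := hi
      rw [hxf]
      refine (norm_mul_le_mulVec_norm (P := P.submatrix f f) (fun _ _ => hP _ _)
        (by rw [h]; rfl)).trans_eq ?_
      exact (sum_mul_extend_zero hf (fun i => P (f j) i) fun j => ‖z j‖).symm
    · rw [hxn i hi, mul_zero]
      exact Finset.sum_nonneg fun l _ => mul_nonneg (hP i l).le (hx0 l)

end Perron

/-! ### Matrices that are signature similar to a positive matrix -/

/-- `D B D` has only positive entries for some diagonal matrix `D` with diagonal entries `±1`. -/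
def IsSignaturePositive {ι : Type*} (B : Matrix ι ι ℝ) : Prop :=
  ∃ d : ι → ℝ, (∀ i, d i * d i = 1) ∧ ∀ i j, 0 < d i * B i j * d j

/-- `lam` is an eigenvalue of `M`: it has a nonzero eigenvector. -/
def IsEigenvalueOf {ι R : Type*} [Fintype ι] [Semiring R] (M : Matrix ι ι R) (lam : R) : Prop :=
  ∃ z : ι → R, z ≠ 0 ∧ M.mulVec z = lam • z

lemma IsSJS.isSignaturePositive {ι : Type*} {B : Matrix ι ι ℝ} (hB : IsSJS B) :
    IsSignaturePositive B := by
  classical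
  obtain ⟨⟨J, hpos, hneg⟩, hne⟩ := hB
  refine ⟨fun i => if i ∈ J then 1 else -1, fun i => by by_cases hi : i ∈ J <;> simp [hi], fun i j => ?_⟩
  by_cases hi : i ∈ J <;> by_cases hj : j ∈ J
  · simpa [hi, hj] using lt_of_le_of_ne (hpos i j (.inl ⟨hi, hj⟩)) (hne i j).symm
  · simpa [hi, hj] using lt_of_le_of_ne (hneg i j (.inl ⟨hi, hj⟩)) (hne i j)
  · simpa [hi, hj] using lt_of_le_of_ne (hneg i j (.inr ⟨hi, hj⟩)) (hne i j)
  · simpa [hi, hj] using lt_of_le_of_ne (hpos i j (.inr ⟨hi, hj⟩)) (hne i j).symm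

section Eigenvalues

variable {ι κ : Type} [Fintype ι] [Fintype κ]

lemma isEigenvalueOf_iff_det [DecidableEq ι] {K : Type*} [Field K] {M : Matrix ι ι K} {lam : K} :
    IsEigenvalueOf M lam ↔ (Matrix.scalar ι lam - M).det = 0 := by
  rw [← Matrix.exists_mulVec_eq_zero_iff]
  refine exists_congr fun z => and_congr_right fun _ => ?_
  rw [Matrix.sub_mulVec, sub_eq_zero, eq_comm, Matrix.scalar_apply, ← Matrix.smul_one_eq_diagonal,
    Matrix.smul_mulVec, Matrix.one_mulVec]

lemma isEigenvalueOf_iff_isRoot [DecidableEq ι] {K : Type*} [Field K] {M : Matrix ι ι K}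
    {lam : K} : IsEigenvalueOf M lam ↔ M.charpoly.IsRoot lam := by
  rw [isEigenvalueOf_iff_det, Polynomial.IsRoot, Matrix.eval_charpoly]

lemma isEigenvalueOf_iff_mem_spectrum [DecidableEq ι] {K : Type*} [Field K] {M : Matrix ι ι K}
    {lam : K} : IsEigenvalueOf M lam ↔ lam ∈ spectrum K M := by
  rw [isEigenvalueOf_iff_isRoot, Matrix.mem_spectrum_iff_isRoot_charpoly]

lemma isEigenvalueOf_map_ofReal [DecidableEq ι] {M : Matrix ι ι ℝ} {lam : ℝ} :
    IsEigenvalueOf (M.map Complex.ofReal) (lam : ℂ) ↔ IsEigenvalueOf M lam := by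
  rw [isEigenvalueOf_iff_isRoot, isEigenvalueOf_iff_isRoot]
  change (M.map Complex.ofRealHom).charpoly.IsRoot (Complex.ofRealHom lam) ↔ _
  rw [Matrix.charpoly_map, Polynomial.isRoot_map_iff Complex.ofRealHom.injective]

lemma IsEigenvalueOf.inv [DecidableEq ι] {K : Type*} [Field K] {M : Matrix ι ι K} {lam : K}
    (hM : IsUnit M.det) (h : IsEigenvalueOf M lam) : lam ≠ 0 ∧ IsEigenvalueOf M⁻¹ lam⁻¹ := by
  obtain ⟨z, hz, h⟩ := h
  have h1 : z = lam • M⁻¹.mulVec z := by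
    rw [← Matrix.mulVec_smul, ← h, Matrix.mulVec_mulVec, Matrix.nonsing_inv_mul _ hM,
      Matrix.one_mulVec]
  have h0 : lam ≠ 0 := by
    rintro rfl
    exact hz (by simpa using h1)
  refine ⟨h0, z, hz, ?_⟩
  conv_rhs => rw [h1]
  rw [smul_smul, inv_mul_cancel₀ h0, one_smul]

lemma IsEigenvalueOf.conj_signature {R : Type*} [CommRing R] {M : Matrix ι ι R} {lam : R}
    {d : ι → R} (hd : ∀ i, d i * d i = 1) (h : IsEigenvalueOf M lam) :
    IsEigenvalueOf (Matrix.of fun i j => d i * M i j * d j) lam := by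
  obtain ⟨z, hz, h⟩ := h
  refine ⟨fun i => d i * z i, fun h0 => hz (funext fun i => ?_), funext fun i => ?_⟩
  · have := congrFun h0 i
    simp only [Pi.zero_apply] at this ⊢
    rw [← one_mul (z i), ← hd, mul_assoc, this, mul_zero]
  · have := congrFun h i
    simp only [Matrix.mulVec, dotProduct, Pi.smul_apply, smul_eq_mul, Matrix.of_apply] at this ⊢
    rw [mul_left_comm, ← this, Finset.mul_sum]
    refine Finset.sum_congr rfl fun j _ => ?_
    calc d i * M i j * d j * (d j * z j) = d i * (M i j * z j) * (d j * d j) := by ring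
      _ = _ := by rw [hd, mul_one]

/-- Perron's theorem for a matrix that is signature similar to a positive one, with the strict
comparison between its Perron root and the eigenvalues of proper principal submatrices. The last
clause is the minimum principle, in the form in which it applies to `B = A⁻¹`: column `k` of `B` is,
after the signature similarity, of constant sign. -/
theorem IsSignaturePositive.exists_perron_root [DecidableEq ι] [Nonempty ι] {B : Matrix ι ι ℝ}
    (hB : IsSignaturePositive B) :
    ∃ ρ : ℝ, 0 < ρ ∧ IsEigenvalueOf B ρ ∧
      (∀ z : ℂ, IsEigenvalueOf (B.map Complex.ofReal) z → ‖z‖ ≤ ρ ∧ (‖z‖ = ρ → z = ρ)) ∧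
      (∀ (κ : Type) [Fintype κ] (f : κ → ι), Function.Injective f → ∀ k ∉ Set.range f,
        ∀ z : ℂ, IsEigenvalueOf ((B.submatrix f f).map Complex.ofReal) z → ‖z‖ < ρ) ∧
      (∀ (μ : ℝ) (y : ι → ℝ) (k : ι), 0 < μ → μ * ρ ≤ 1 → y k = 0 →
        (∃ c : ℝ, y - μ • B.mulVec y = c • B.mulVec (Pi.single k 1)) → y = 0) := by
  obtain ⟨d, hd, hpos⟩ := hB
  set P : Matrix ι ι ℝ := Matrix.of fun i j => d i * B i j * d j with hPdef
  have hP : ∀ i j, 0 < P i j := hpos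
  obtain ⟨ρ, hρ, v, hv, hPv⟩ := exists_perron_eigenvector hP
  have hd' : ∀ i, (d i : ℂ) * d i = 1 := fun i => by exact_mod_cast hd i
  have hBP : B = Matrix.of fun i j => d i * P i j * d j := by
    ext i j
    simp only [hPdef, Matrix.of_apply]
    calc B i j = (d i * d i) * B i j * (d j * d j) := by rw [hd, hd]; ring
      _ = _ := by ring
  refine ⟨ρ, hρ, ?_, ?_, ?_, ?_⟩
  · rw [hBP]
    obtain ⟨i⟩ := ‹Nonempty ι›
    exact IsEigenvalueOf.conj_signature hd ⟨v, fun h => (hv i).ne' (congrFun h i), hPv⟩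
  · intro z hz
    obtain ⟨w, hw, h⟩ := hz.conj_signature hd'
    have h' : (P.map Complex.ofReal).mulVec w = z • w := by
      rw [← h]
      congr 1
      ext i j
      simp [hPdef]
    exact ⟨norm_eigenvalue_le_perron hP hv hPv hw h', eigenvalue_eq_perron hP hv hPv hw h'⟩
  · intro κ _ f hf k hk z hz
    obtain ⟨w, hw, h⟩ := hz.conj_signature (d := fun j => (d (f j) : ℂ)) fun j => hd' (f j)
    refine norm_eigenvalue_submatrix_lt_perron hP hv hPv hf hk hw ?_
    rw [← h]
    congr 1
    ext i j
    simp [hPdef]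
  · rintro μ y k hμ hμρ hyk ⟨c, hc⟩
    -- Up to the sign of `y`, the conjugated vector satisfies `y ≥ μ P y`.
    have main : ∀ (y : ι → ℝ) (c : ℝ), y k = 0 → 0 ≤ c * d k →
        y - μ • B.mulVec y = c • B.mulVec (Pi.single k 1) → y = 0 := by
      intro y c hyk hck hc
      have hPy : ∀ i, (P.mulVec fun j => d j * y j) i = d i * (B.mulVec y) i := by
        intro i
        simp only [Matrix.mulVec, dotProduct, hPdef, Matrix.of_apply, Finset.mul_sum]
        refine Finset.sum_congr rfl fun j _ => ?_
        calc d i * B i j * d j * (d j * y j) = d i * (B i j * y j) * (d j * d j) := by ring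
          _ = _ := by rw [hd, mul_one]
      have h0 : (fun j => d j * y j) = 0 := by
        refine eq_zero_of_mulVec_le hP hv hPv hμ hμρ (k := k) (by simp [hyk]) fun i => ?_
        rw [hPy]
        have h1 := congrFun hc i
        simp only [Matrix.mulVec_single_one, Pi.sub_apply, Pi.smul_apply, smul_eq_mul,
          Matrix.col_apply] at h1
        have h2 : 0 ≤ c * d k * (d i * B i k * d k) := mul_nonneg hck (hpos i k).le
        have h3 : c * d k * (d i * B i k * d k) = d i * (c * B i k) * (d k * d k) := by ring
        rw [h3, hd, mul_one, ← h1] at h2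
        linarith
      funext j
      have := congrFun h0 j
      simp only [Pi.zero_apply] at this ⊢
      rw [← one_mul (y j), ← hd, mul_assoc, this, mul_zero]
    rcases le_total 0 (c * d k) with h | h
    · exact main y c hyk h hc
    · refine neg_eq_zero.1 (main (-y) (-c) (by simp [hyk]) (by linarith) ?_)
      rw [Matrix.mulVec_neg, neg_smul, ← hc]
      simp only [smul_neg]
      abel

end Eigenvalues

/-! ### The smallest real eigenvalue -/

/-- The two consequences of strict total J-sign-symmetry that govern the smallest eigenvalue: the
inverse is signature similar to a positive matrix, and there is no eigenvalue in `(-∞, 0]`. The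
notion makes sense for an arbitrary index type. -/
def HasPerronInverse {ι : Type*} [Fintype ι] [DecidableEq ι] (A : Matrix ι ι ℝ) : Prop :=
  IsSignaturePositive A⁻¹ ∧ ∀ t : ℝ, 0 ≤ t → 0 < (A + t • (1 : Matrix ι ι ℝ)).det

section Smallest

variable {ι κ : Type} [Fintype ι] [Fintype κ] [DecidableEq ι] [DecidableEq κ]

lemma HasPerronInverse.submatrix_equiv {A : Matrix ι ι ℝ} (hA : HasPerronInverse A) (e : κ ≃ ι) :
    HasPerronInverse (A.submatrix e e) := by
  obtain ⟨⟨d, hd, hpos⟩, hdet⟩ := hA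
  refine ⟨⟨fun i => d (e i), fun i => hd _, fun i j => ?_⟩, fun t ht => ?_⟩
  · rw [Matrix.inv_submatrix_equiv]
    exact hpos _ _
  · rw [← Matrix.submatrix_one_equiv e]
    exact (hdet t ht).trans_eq (Matrix.det_submatrix_equiv_self e _).symm

lemma HasPerronInverse.isUnit_det {A : Matrix ι ι ℝ} (hA : HasPerronInverse A) :
    IsUnit A.det := by
  have := hA.2 0 le_rfl
  rw [zero_smul, add_zero] at this
  exact this.ne'.isUnit

lemma HasPerronInverse.eigenvalue_pos {A : Matrix ι ι ℝ} (hA : HasPerronInverse A) {x : ℝ}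
    (hx : IsEigenvalueOf A x) : 0 < x := by
  by_contra h
  obtain ⟨z, hz, hzx⟩ := hx
  refine (hA.2 (-x) (by linarith)).ne' (Matrix.exists_mulVec_eq_zero_iff.1 ⟨z, hz, ?_⟩)
  rw [Matrix.add_mulVec, hzx, Matrix.smul_mulVec, Matrix.one_mulVec, neg_smul, add_neg_cancel]

/-- The inverse of the Perron root of `A⁻¹` is the smallest real eigenvalue of `A`, the unique
eigenvalue of smallest modulus, and less than the positive eigenvalues of every principal submatrix
obtained by deleting one index: an eigenvector `y` of the submatrix, extended by zero, satisfies
`y - μ A⁻¹ y = c A⁻¹ eₖ`, to which the minimum principle applies. -/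
theorem HasPerronInverse.exists_smallest [Nonempty ι] {A : Matrix ι ι ℝ}
    (hA : HasPerronInverse A) :
    ∃ l : ℝ, 0 < l ∧ IsEigenvalueOf A l ∧ minRealEigenvalue A = (l : EReal) ∧
      (∀ z : ℂ, IsEigenvalueOf (A.map Complex.ofReal) z → l ≤ ‖z‖ ∧ (‖z‖ = l → z = l)) ∧
      (∀ (κ : Type) [Fintype κ] (f : κ → ι), Function.Injective f → ∀ k : ι,
        Set.range f = {k}ᶜ → ∀ μ : ℝ, 0 < μ → IsEigenvalueOf (A.submatrix f f) μ → l < μ) := by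
  have hu := hA.isUnit_det
  obtain ⟨ρ, hρ, hev, hperron, -, hmin⟩ := hA.1.exists_perron_root
  have hevA : IsEigenvalueOf A ρ⁻¹ := by
    have := (hev.inv (by simpa [Matrix.isUnit_nonsing_inv_det_iff] using hu)).2
    rwa [Matrix.nonsing_inv_nonsing_inv _ hu] at this
  have hmod : ∀ z : ℂ, IsEigenvalueOf (A.map Complex.ofReal) z →
      ρ⁻¹ ≤ ‖z‖ ∧ (‖z‖ = ρ⁻¹ → z = (ρ⁻¹ : ℝ)) := by
    intro z hz
    have hdet : (A.map Complex.ofReal).det = (A.det : ℂ) :=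
      (RingHom.map_det Complex.ofRealHom A).symm
    have hinv : (A.map Complex.ofReal)⁻¹ = A⁻¹.map Complex.ofReal := by
      refine Matrix.inv_eq_left_inv ?_
      change A⁻¹.map Complex.ofRealHom * A.map Complex.ofRealHom = 1
      rw [← Matrix.map_mul, Matrix.nonsing_inv_mul _ hu]
      exact Matrix.map_one _ (map_zero _) (map_one _)
    obtain ⟨hz0, hzi⟩ := hz.inv (by
      rw [hdet]
      exact (Complex.ofReal_ne_zero.2 hu.ne_zero).isUnit)
    rw [hinv] at hzi
    obtain ⟨h1, h2⟩ := hperron _ hzi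
    rw [norm_inv] at h1 h2
    have hzp : 0 < ‖z‖ := norm_pos_iff.2 hz0
    refine ⟨inv_le_of_inv_le₀ hzp h1, fun h => ?_⟩
    rw [h, inv_inv] at h2
    rw [← inv_inv z, h2 rfl, Complex.ofReal_inv]
  refine ⟨ρ⁻¹, inv_pos.2 hρ, hevA, ?_, hmod, ?_⟩
  · refine le_antisymm (sInf_le ⟨ρ⁻¹, isEigenvalueOf_iff_mem_spectrum.1 hevA, rfl⟩) (le_sInf ?_)
    rintro _ ⟨x, hx, rfl⟩
    have hx' := isEigenvalueOf_iff_mem_spectrum.2 hx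
    have h1 := (hmod x (isEigenvalueOf_map_ofReal.2 hx')).1
    rw [Complex.norm_real, Real.norm_of_nonneg (hA.eigenvalue_pos hx').le] at h1
    exact EReal.coe_le_coe_iff.2 h1
  · intro κ _ f hf k hk μ hμ hμev
    by_contra hle
    obtain ⟨y, hy, hyμ⟩ := hμev
    set x : ι → ℝ := Function.extend f y 0 with hx
    have hxf : ∀ j, x (f j) = y j := fun j => hf.extend_apply _ _ j
    have hxk : x k = 0 := Function.extend_apply' _ _ _ (by
      have : k ∉ Set.range f := by rw [hk]; simp
      simpa using this)
    have hAx : A.mulVec x = μ • x + (A.mulVec x) k • Pi.single k 1 := by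
      funext i
      by_cases hi : i = k
      · subst hi
        simp [hxk]
      · obtain ⟨j, rfl⟩ : i ∈ Set.range f := by rw [hk]; exact hi
        have h1 : (A.mulVec x) (f j) = μ * y j := by
          rw [← smul_eq_mul, ← Pi.smul_apply, ← hyμ]
          exact sum_mul_extend_zero hf (fun i => A (f j) i) y
        rw [h1]
        simp [hxf, Pi.single_eq_of_ne hi]
    have hB := congrArg A⁻¹.mulVec hAx
    rw [Matrix.mulVec_mulVec, Matrix.nonsing_inv_mul _ hu, Matrix.one_mulVec, Matrix.mulVec_add,
      Matrix.mulVec_smul, Matrix.mulVec_smul] at hB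
    have hx0 := hmin μ x k hμ
      (by simpa using (le_inv_mul_iff₀' hρ).1 (by simpa using not_lt.1 hle))
      hxk ⟨_, sub_eq_of_eq_add' hB⟩
    exact hy (funext fun j => by rw [← hxf, hx0]; rfl)

end Smallest

/-! ### Strictly totally J-sign-symmetric matrices -/

/-- For a matrix with nonnegative principal minors and positive determinant, `det (A + t)` is
positive for `t ≥ 0`: expand it, by multilinearity in the rows, into the principal minors. -/
lemma det_add_smul_one_pos {ι : Type*} [Fintype ι] [DecidableEq ι] {A : Matrix ι ι ℝ}
    (hA : ∀ S : Finset ι, 0 ≤ (A.submatrix (Subtype.val : S → ι) Subtype.val).det)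
    (hdet : 0 < A.det) {t : ℝ} (ht : 0 ≤ t) : 0 < (A + t • (1 : Matrix ι ι ℝ)).det := by
  set N : Finset ι → Matrix ι ι ℝ := fun S =>
    Matrix.of fun i j => if i ∈ S then A i j else (t • (1 : Matrix ι ι ℝ)) i j with hN
  have hexp : (A + t • (1 : Matrix ι ι ℝ)).det = ∑ S : Finset ι, (N S).det := by
    refine (Matrix.detRowAlternating.toMultilinearMap.map_add_univ
      A (t • (1 : Matrix ι ι ℝ))).trans (Finset.sum_congr rfl fun S _ => ?_)
    change Matrix.det _ = _
    congr 1
    ext i j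
    by_cases hi : i ∈ S <;> simp only [Finset.piecewise, hi, hN, Matrix.of_apply, if_true, if_false]
  rw [hexp]
  refine Finset.sum_pos' (fun S _ => ?_) ⟨Finset.univ, Finset.mem_univ _, ?_⟩
  · rw [Matrix.twoBlockTriangular_det _ (· ∈ S)]
    · refine mul_nonneg ?_ ?_
      · have : (N S).toSquareBlockProp (fun i => i ∈ S) = A.submatrix Subtype.val Subtype.val := by
          ext i j
          simp [Matrix.toSquareBlockProp, hN]
        rw [this]
        refine (hA S).trans_eq ?_
        congr!
      · have : (N S).toSquareBlockProp (fun i => ¬ i ∈ S) = t • (1 : Matrix _ _ ℝ) := by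
          ext i j
          simp [Matrix.toSquareBlockProp, hN, i.2, Matrix.one_apply, Subtype.ext_iff]
        rw [this, Matrix.det_smul, Matrix.det_one, mul_one]
        exact pow_nonneg ht _
    · intro i hi j hj
      have hij : i ≠ j := fun h => hi (h ▸ hj)
      simp [hN, hi, hij]
  · have : N Finset.univ = A := by
      ext i j
      simp [hN]
    rwa [this]

lemma IsSJS.submatrix {ι κ : Type*} {B : Matrix ι ι ℝ} (hB : IsSJS B) (f : κ → ι) :
    IsSJS (B.submatrix f f) := by
  obtain ⟨⟨J, h1, h2⟩, h3⟩ := hB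
  exact ⟨⟨f ⁻¹' J, fun i j => h1 _ _, fun i j => h2 _ _⟩, fun i j => h3 _ _⟩

lemma IsSTJS.submatrix {n p : ℕ} {A : Matrix (Fin n) (Fin n) ℝ} (hA : IsSTJS A)
    (f : Fin p ↪o Fin n) : IsSTJS (A.submatrix f f) := by
  intro j h1 hj
  have hpn : p ≤ n := by simpa using Fintype.card_le_of_injective f f.injective
  exact (hA j h1 (hj.trans hpn)).submatrix fun α : Fin j ↪o Fin p => α.trans f

lemma IsSTJS.minor_pos {n j : ℕ} {A : Matrix (Fin n) (Fin n) ℝ} (hA : IsSTJS A)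
    (f : Fin j ↪o Fin n) : 0 < (A.submatrix f f).det := by
  rcases Nat.eq_zero_or_pos j with rfl | hj
  · simp
  have hjn : j ≤ n := by simpa using Fintype.card_le_of_injective f f.injective
  obtain ⟨⟨J, h1, -⟩, h2⟩ := hA j hj hjn
  exact lt_of_le_of_ne (h1 f f (by tauto)) (h2 f f).symm

lemma submatrix_val_eq {n : ℕ} (A : Matrix (Fin n) (Fin n) ℝ) (S : Finset (Fin n)) {p : ℕ}
    (h : S.card = p) :
    (A.submatrix (S.orderEmbOfFin h) (S.orderEmbOfFin h)).submatrix
      (S.orderIsoOfFin h).symm.toEquiv (S.orderIsoOfFin h).symm.toEquiv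
        = A.submatrix (Subtype.val : S → Fin n) Subtype.val := by
  ext i j
  simp [← Finset.coe_orderIsoOfFin_apply]

lemma IsSTJS.det_add_smul_one_pos {n : ℕ} {A : Matrix (Fin n) (Fin n) ℝ} (hA : IsSTJS A) {t : ℝ}
    (ht : 0 ≤ t) : 0 < (A + t • (1 : Matrix (Fin n) (Fin n) ℝ)).det := by
  refine _root_.det_add_smul_one_pos (fun S => ?_) ?_ ht
  · rw [← submatrix_val_eq A S rfl, Matrix.det_submatrix_equiv_self]
    exact (hA.minor_pos _).le
  · simpa using hA.minor_pos (OrderIso.refl (Fin n)).toOrderEmbedding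

lemma IsSTJS.isSignaturePositive {m : ℕ} {A : Matrix (Fin (m + 1)) (Fin (m + 1)) ℝ}
    (hA : IsSTJS A) : IsSignaturePositive A := by
  -- The entries are the minors of order one.
  have := (hA 1 le_rfl (by omega)).submatrix
    fun i : Fin (m + 1) => OrderEmbedding.ofStrictMono (fun _ : Fin 1 => i) (Subsingleton.strictMono _)
  convert this.isSignaturePositive
  ext i j
  simp [compoundMatrix]

/-- The inverse of an STJS matrix is, up to the signature `(-1)ⁱ` and the positive factor
`1 / det A`, the transposed compound matrix of order `m`. -/
lemma IsSTJS.hasPerronInverse {m : ℕ} {A : Matrix (Fin (m + 1)) (Fin (m + 1)) ℝ}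
    (hA : IsSTJS A) : HasPerronInverse A := by
  refine ⟨?_, fun t ht => hA.det_add_smul_one_pos ht⟩
  have hdet : 0 < A.det := by simpa using hA.det_add_smul_one_pos le_rfl
  -- The compound matrix of order `0` is the `1 × 1` matrix with entry `1`.
  have hc : IsSJS (compoundMatrix A m) := by
    rcases Nat.eq_zero_or_pos m with rfl | hm
    · refine ⟨⟨Set.univ, fun i j _ => ?_, fun i j h => by simp at h⟩, fun i j => ?_⟩ <;>
        simp [compoundMatrix]
    · exact hA m hm (Nat.le_succ m)
  obtain ⟨d, hd, hpos⟩ := hc.isSignaturePositive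
  refine ⟨fun i => (-1) ^ (i : ℕ) * d (Fin.succAboveOrderEmb i), fun i => ?_, fun i j => ?_⟩
  · rw [mul_mul_mul_comm, hd, ← mul_pow]
    simp
  · have h := mul_pos (inv_pos.2 hdet) (hpos (Fin.succAboveOrderEmb j) (Fin.succAboveOrderEmb i))
    have h1 : A⁻¹ i j = A.det⁻¹ * ((-1) ^ (i + j : ℕ) *
        compoundMatrix A m (Fin.succAboveOrderEmb j) (Fin.succAboveOrderEmb i)) := by
      rw [Matrix.inv_def, Matrix.smul_apply, Ring.inverse_eq_inv', smul_eq_mul,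
        Matrix.adjugate_fin_succ_eq_det_submatrix, add_comm (j : ℕ)]
      rfl
    refine h.trans_eq ?_
    rw [h1]
    set a := d (Fin.succAboveOrderEmb i)
    set b := d (Fin.succAboveOrderEmb j)
    set M := compoundMatrix A m (Fin.succAboveOrderEmb j) (Fin.succAboveOrderEmb i)
    have hs : ((-1 : ℝ) ^ (i + j : ℕ)) * (-1) ^ (i + j : ℕ) = 1 := by
      rw [← mul_pow]; simp
    calc A.det⁻¹ * (b * M * a)
        = A.det⁻¹ * (b * M * a) * (((-1 : ℝ) ^ (i + j : ℕ)) * (-1) ^ (i + j : ℕ)) := by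
          rw [hs, mul_one]
      _ = _ := by
          rw [pow_add]
          ring

lemma IsSTJS.hasPerronInverse_principalSubmatrix {n : ℕ} {A : Matrix (Fin n) (Fin n) ℝ}
    (hA : IsSTJS A) {α : Finset (Fin n)} (hα : α.Nonempty) :
    HasPerronInverse (principalSubmatrix A α) := by
  obtain ⟨p, hp⟩ := Nat.exists_eq_succ_of_ne_zero hα.card_pos.ne'
  rw [principalSubmatrix, ← submatrix_val_eq A α hp]
  exact (hA.submatrix _).hasPerronInverse.submatrix_equiv _

/-- Deleting one index at a time from `α` until `β` is left. -/
lemma IsSTJS.minRealEigenvalue_lt {n : ℕ} {A : Matrix (Fin n) (Fin n) ℝ} (hA : IsSTJS A)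
    {β : Finset (Fin n)} (hβ : β.Nonempty) : ∀ {α : Finset (Fin n)}, β ⊂ α →
      minRealEigenvalue (principalSubmatrix A α) < minRealEigenvalue (principalSubmatrix A β) := by
  intro α
  induction α using Finset.strongInduction with
  | H α ih =>
    intro hβα
    obtain ⟨k, hkα, hkβ⟩ := Finset.exists_of_ssubset hβα
    have hβ' : β ⊆ α.erase k := Finset.subset_erase.2 ⟨hβα.1, hkβ⟩
    have hstep : minRealEigenvalue (principalSubmatrix A α)
        < minRealEigenvalue (principalSubmatrix A (α.erase k)) := by
      have hne : (α.erase k).Nonempty := hβ.mono hβ'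
      have : Nonempty α := ⟨⟨k, hkα⟩⟩
      have : Nonempty (α.erase k) := hne.to_subtype
      obtain ⟨l, -, -, hl, -, hlt⟩ :=
        (hA.hasPerronInverse_principalSubmatrix ⟨k, hkα⟩).exists_smallest
      obtain ⟨l', hl'0, hl'e, hl', -⟩ :=
        (hA.hasPerronInverse_principalSubmatrix hne).exists_smallest
      rw [hl, hl', EReal.coe_lt_coe_iff]
      refine hlt (α.erase k) (fun i => ⟨i, Finset.mem_of_mem_erase i.2⟩)
        (fun i j h => Subtype.ext (congrArg (fun x : α => (x : Fin n)) h)) ⟨k, hkα⟩ ?_ l' hl'0 hl'e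
      ext ⟨i, hi⟩
      simp [hi]
    rcases hβ'.eq_or_ssubset with h | h
    · rwa [← h] at hstep
    · exact hstep.trans (ih _ (Finset.erase_ssubset hkα) h)

lemma IsSTJS.isStrictTauMatrix {m : ℕ} {A : Matrix (Fin (m + 1)) (Fin (m + 1)) ℝ}
    (hA : IsSTJS A) : IsStrictTauMatrix A := by
  obtain ⟨l, hl0, -, hl, -⟩ := hA.hasPerronInverse.exists_smallest
  have hpos : 0 < minRealEigenvalue A := by rw [hl]; exact_mod_cast hl0
  refine ⟨⟨hpos.le, fun α β hβ hβα => ⟨?_, ?_⟩⟩, hpos, fun α β hβ => hA.minRealEigenvalue_lt hβ⟩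
  · rcases hβα.eq_or_ssubset with rfl | h
    · exact le_rfl
    · exact (hA.minRealEigenvalue_lt hβ h).le
  · have : Nonempty β := hβ.to_subtype
    obtain ⟨l', -, -, hl', -⟩ := (hA.hasPerronInverse_principalSubmatrix hβ).exists_smallest
    rw [hl']
    exact EReal.coe_lt_top l'

lemma IsEigenvalueList.mem_iff {n : ℕ} {A : Matrix (Fin n) (Fin n) ℝ} {ev : Fin n → ℂ}
    (h : IsEigenvalueList A ev) {z : ℂ} :
    IsEigenvalueOf (A.map Complex.ofReal) z ↔ ∃ i, ev i = z := by
  rw [isEigenvalueOf_iff_isRoot, ← Polynomial.mem_roots (Matrix.charpoly_monic _).ne_zero, ← h.1]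
  simp

/-- The first eigenvalue in the list is the Perron root of `A`. -/
lemma IsSTJS.exists_largest {m : ℕ} {A : Matrix (Fin (m + 1)) (Fin (m + 1)) ℝ} (hA : IsSTJS A)
    {lam : Fin (m + 1) → ℂ} (hlam : IsEigenvalueList A lam) :
    ∃ ρ : ℝ, lam 0 = ρ ∧ ∀ (κ : Type) [Fintype κ] (f : κ → Fin (m + 1)), Function.Injective f →
      ∀ k ∉ Set.range f, ∀ z : ℂ,
        IsEigenvalueOf ((A.submatrix f f).map Complex.ofReal) z → ‖z‖ < ρ := by
  obtain ⟨ρ, hρ, hev, hmax, hsub, -⟩ := hA.isSignaturePositive.exists_perron_root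
  refine ⟨ρ, ?_, hsub⟩
  obtain ⟨h1, h2⟩ := hmax _ (hlam.mem_iff.2 ⟨0, rfl⟩)
  obtain ⟨i, hi⟩ := hlam.mem_iff.1 (isEigenvalueOf_map_ofReal.2 hev)
  refine h2 (le_antisymm h1 ?_)
  have h3 := hlam.2 (Fin.zero_le i)
  simp only [hi, Complex.norm_real, Real.norm_of_nonneg hρ.le] at h3
  exact h3

/-- The last eigenvalue in the list is the smallest real eigenvalue of `A`. -/
lemma IsSTJS.exists_smallest {m : ℕ} {A : Matrix (Fin (m + 1)) (Fin (m + 1)) ℝ} (hA : IsSTJS A)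
    {lam : Fin (m + 1) → ℂ} (hlam : IsEigenvalueList A lam) :
    ∃ l : ℝ, 0 < l ∧ IsEigenvalueOf A l ∧ lam (Fin.last m) = l ∧
      ∀ (κ : Type) [Fintype κ] (f : κ → Fin (m + 1)), Function.Injective f → ∀ k,
        Set.range f = {k}ᶜ → ∀ μ : ℝ, 0 < μ → IsEigenvalueOf (A.submatrix f f) μ → l < μ := by
  obtain ⟨l, hl0, hev, -, hmin, hsub⟩ := hA.hasPerronInverse.exists_smallest
  refine ⟨l, hl0, hev, ?_, hsub⟩
  obtain ⟨h1, h2⟩ := hmin _ (hlam.mem_iff.2 ⟨Fin.last m, rfl⟩)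
  obtain ⟨i, hi⟩ := hlam.mem_iff.1 (isEigenvalueOf_map_ofReal.2 hev)
  refine h2 (le_antisymm ?_ h1)
  have h3 := hlam.2 (Fin.le_last i)
  simp only [hi, Complex.norm_real, Real.norm_of_nonneg hl0.le] at h3
  exact h3

theorem theorem6 (m : ℕ) (A : Matrix (Fin (m + 1)) (Fin (m + 1)) ℝ) (hA : IsSTJS A) :
    (∀ (hm : 0 < m) (lam : Fin (m + 1) → ℂ), IsEigenvalueList A lam →
      ∀ (k : Fin (m + 1)) (mu : Fin m → ℂ), IsEigenvalueList (deleteRowCol A k) mu →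
        ((lam 0).im = 0 ∧ (mu ⟨0, hm⟩).im = 0 ∧ (mu ⟨0, hm⟩).re < (lam 0).re) ∧
        ((lam (Fin.last m)).im = 0 ∧ (mu ⟨m - 1, Nat.sub_lt hm Nat.one_pos⟩).im = 0 ∧
          (lam (Fin.last m)).re < (mu ⟨m - 1, Nat.sub_lt hm Nat.one_pos⟩).re)) ∧
    IsStrictTauMatrix A := by
  refine ⟨fun hm lam hlam k mu hmu => ?_, hA.isStrictTauMatrix⟩
  obtain ⟨p, rfl⟩ := Nat.exists_eq_succ_of_ne_zero hm.ne'
  have hk : IsSTJS (deleteRowCol A k) := hA.submatrix (Fin.succAboveOrderEmb k)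
  have hinj : Function.Injective k.succAbove := Fin.succAbove_right_injective
  constructor
  · obtain ⟨ρ, hρ, hsub⟩ := hA.exists_largest hlam
    obtain ⟨σ, hσ, -⟩ := hk.exists_largest hmu
    have hσ' : mu ⟨0, hm⟩ = σ := hσ
    rw [hρ, hσ']
    refine ⟨Complex.ofReal_im _, Complex.ofReal_im _, ?_⟩
    have h := hsub _ k.succAbove hinj k (by simp) (mu 0) (hmu.mem_iff.2 ⟨0, rfl⟩)
    rw [hσ] at h
    exact (Complex.re_le_norm _).trans_lt h
  · obtain ⟨l, -, -, hl, hsub⟩ := hA.exists_smallest hlam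
    obtain ⟨μ, hμ0, hμe, hμ, -⟩ := hk.exists_smallest hmu
    have hμ' : mu ⟨p.succ - 1, Nat.sub_lt hm Nat.one_pos⟩ = μ := hμ
    rw [hl, hμ']
    exact ⟨Complex.ofReal_im _, Complex.ofReal_im _,
      hsub _ k.succAbove hinj k (Fin.range_succAbove k) μ hμ0 hμe⟩
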